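/- Let $\mathcal{T}$ be a triangulated category with shift functor $[1]$. Let $\mathcal{H}$ be a full subcategory of $\mathcal{T}$ that contains a zero object of $\mathcal{T}$, is closed under extensions and direct summands in $\mathcal{T}$, and satisfies $\mathcal{T}(A,B[-1])=0$ for all $A,B\in\mathcal{H}$. Regard $\mathcal{H}$ as an exact category: $A\to B\to C$ in $\mathcal{H}$ is a conflation if $A\to B\to C\to A[1]$ is a distinguished triangle in $\mathcal{T}$ for some $C\to A[1]$. Let $\mathrm{Ext}^n_{\mathcal{H}}(A,B)$ be the Yoneda extension groups of this exact category, and let $\mathrm{Ext}^n_{\mathcal{H}}(A,B)\to\mathcal{T}(A,B[n])$, $n\ge 0$, be the map that sends an exact sequence spliced from $n$ conflations to the composite of the (shifted) connecting morphisms of the corresponding triangles (for $n=0$ it is the identity on morphisms). Assume that $\mathcal{T}$ has all the Ext groups of $\mathcal{H}$, that is, these maps are isomorphisms for all $n\ge 0$ and all $A,B\in\mathcal{H}$. **Terminology.** Let $\mathcal{C}$ be either $\mathcal{T}$, where the conflations are the sequences $A\to B\to C$ that extend to a distinguished triangle and $\mathbb{E}^i(X,Y)=\mathcal{T}(X,Y[i])$,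 or $\mathcal{H}$, with the conflations above and $\mathbb{E}^i=\mathrm{Ext}^i_{\mathcal{H}}$. For classes $\mathcal{X},\mathcal{Y}$ of objects, $\mathbb{E}^i(\mathcal{X},\mathcal{Y})=0$ means $\mathbb{E}^i(X,Y)=0$ for all $X\in\mathcal{X}$, $Y\in\mathcal{Y}$. * $\mathcal{X}\subseteq\mathcal{C}$ is *left thick* if it is closed under extensions, direct summands in $\mathcal{C}$ and cocones (if $A\to B\to C$ is a conflation with $B,C\in\mathcal{X}$, then $A\in\mathcal{X}$); it is *right thick* if it is closed under extensions, direct summands in $\mathcal{C}$ and cones (if $A,B\in\mathcal{X}$, then $C\in\mathcal{X}$). * $\mathcal{X}^\wedge_m$ is the class of objects $C$ that have, for some $k\le m$, a finite resolution $0\to X_k\to\cdots\to X_0\to C\to 0$, spliced from conflations, with all $X_j\in\mathcal{X}$; $\mathcal{X}^\wedge=\bigcup_m\mathcal{X}^\wedge_m$; and $\mathcal{X}^\vee_m$ is defined dually by coresolutions. * $\omega$ is a *relative cogenerator* in $\mathcal{X}$ if $\omega\subseteq\mathcal{X}$ and each $X\in\mathcal{X}$ has a conflation $X\to W\to X'$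 with $W\in\omega$, $X'\in\mathcal{X}$. Dually, it is a *relative generator* in $\mathcal{X}$ if $\omega\subseteq\mathcal{X}$ and each $X\in\mathcal{X}$ has a conflation $X'\to W\to X$ with $W\in\omega$, $X'\in\mathcal{X}$. * $(\mathcal{X},\omega)$ is a *left Frobenius pair in $\mathcal{C}$* if $\mathcal{X}$ is left thick, $\omega$ is closed under direct summands in $\mathcal{C}$, $\omega$ is a relative cogenerator in $\mathcal{X}$, and $\mathbb{E}^i(\mathcal{X},\omega)=0$ for all $i\ge1$. * $(\mathcal{A},\mathcal{B})$ is a *left weak AB-context in $\mathcal{C}$* if, with $\omega=\mathcal{A}\cap\mathcal{B}$: $(\mathcal{A},\omega)$ is a left Frobenius pair in $\mathcal{C}$; $\omega$ is closed under extensions and direct summands, is a relative generator in $\omega$, and satisfies $\mathbb{E}^i(\omega,\omega)=0$ for all $i\ge 1$; $\mathcal{B}$ is right thick; and $\mathcal{B}\subseteq\mathcal{A}^\wedge$. * For $n\ge1$, $(\mathcal{F},\mathcal{G})$ is an *$n$-cotorsion pair cut on $\mathcal{S}$ in $\mathcal{C}$* if $\mathcal{F}$ and $\mathcal{G}$ are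 closed under direct summands in $\mathcal{C}$; $\mathbb{E}^i(\mathcal{F}\cap\mathcal{S},\mathcal{G})=0$ and $\mathbb{E}^i(\mathcal{F},\mathcal{G}\cap\mathcal{S})=0$ for $1\le i\le n$; and each $S\in\mathcal{S}$ has conflations $K\to F\to S$ with $F\in\mathcal{F}$, $K\in\mathcal{G}^\wedge_{n-1}$, and $S\to G\to L$ with $G\in\mathcal{G}$, $L\in\mathcal{F}^\vee_{n-1}$. **Proposition.** The following statements hold. 1. Let $\mathcal{X},\omega\subseteq\mathcal{H}$ be such that $(\mathcal{X},\omega)$ is a left Frobenius pair in the exact category $\mathcal{H}$. Then $(\mathcal{X},\omega)$ is a left Frobenius pair in $\mathcal{T}$ if and only if $\mathcal{X}[-1]\subseteq\mathcal{X}$. 2. Let $\mathcal{A},\mathcal{B}\subseteq\mathcal{H}$ be such that $(\mathcal{A},\mathcal{B})$ is a left weak AB-context in the exact category $\mathcal{H}$. Then $(\mathcal{A},\mathcal{B})$ is a left weak AB-context in $\mathcal{T}$ if and only if $\mathcal{A}[-1]\subseteq\mathcal{A}$ and $\mathcal{B}[1]\subseteq\mathcal{B}$. 3. For every $n\ge1$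 and all $\mathcal{F},\mathcal{G},\mathcal{S}\subseteq\mathcal{H}$, if $(\mathcal{F},\mathcal{G})$ is an $n$-cotorsion pair cut on $\mathcal{S}$ in the exact category $\mathcal{H}$, then it is an $n$-cotorsion pair cut on $\mathcal{S}$ in $\mathcal{T}$. -/

import Mathlib

open CategoryTheory Limits Pretriangulated

universe w v u

namespace CutAB

/-! ### Conflations and higher extension groups -/

/-- The part of the structure of an extriangulated category with higher extension groups that the
notions below use: the class of conflations `A ⟶ B ⟶ Z`, and the higher extension groups
`𝔼^i(X, Y)` (only the degrees `1 ≤ i` are used). It is only ever used for the two explicit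
structures `triangulatedData` (on a triangulated category) and `exactData` (on an extension-closed
subcategory of a triangulated category). -/
structure ExtriData (C : Type u) [Category.{v} C] where
  /-- `A ⟶ B ⟶ Z` is a conflation -/
  conflation : ∀ ⦃A B Z : C⦄, (A ⟶ B) → (B ⟶ Z) → Prop
  /-- the extension group `𝔼^i(X, Y)` -/
  E : ℕ → C → C → Type w

section Notions

variable {C : Type u} [Category.{v} C] (D : ExtriData.{w} C)

/-- `X` is closed under extensions. -/
def ClosedUnderExtensions (X : ObjectProperty C) : Prop :=
  ∀ ⦃A B Z : C⦄ (f : A ⟶ B) (g : B ⟶ Z), D.conflation f g → X A → X Z → X B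

/-- `X` is closed under cones. -/
def ClosedUnderCones (X : ObjectProperty C) : Prop :=
  ∀ ⦃A B Z : C⦄ (f : A ⟶ B) (g : B ⟶ Z), D.conflation f g → X A → X B → X Z

/-- `X` is closed under cocones. -/
def ClosedUnderCocones (X : ObjectProperty C) : Prop :=
  ∀ ⦃A B Z : C⦄ (f : A ⟶ B) (g : B ⟶ Z), D.conflation f g → X B → X Z → X A

/-- `X` is closed under direct summands in `C`: if a biproduct of `A` and `B` is in `X`, so is
`A`. -/
def ClosedUnderSummands [HasZeroMorphisms C] (X : ObjectProperty C) : Prop :=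
  ∀ ⦃A B : C⦄ (b : BinaryBicone A B), Nonempty b.IsBilimit → X b.pt → X A

/-- Left thick: closed under extensions, direct summands and cocones. -/
structure IsLeftThick [HasZeroMorphisms C] (X : ObjectProperty C) : Prop where
  extensions : ClosedUnderExtensions D X
  summands : ClosedUnderSummands X
  cocones : ClosedUnderCocones D X

/-- Right thick: closed under extensions, direct summands and cones. -/
structure IsRightThick [HasZeroMorphisms C] (X : ObjectProperty C) : Prop where
  extensions : ClosedUnderExtensions D X
  summands : ClosedUnderSummands X
  cones : ClosedUnderCones D X

/-- `HasResolution D X n Z`: there is a finite `X`-resolution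
`0 ⟶ X_n ⟶ ⋯ ⟶ X_1 ⟶ X_0 ⟶ Z ⟶ 0` of length `n`, spliced from conflations
`Z_{k+1} ⟶ X_k ⟶ Z_k` with `Z_0 = Z` and `Z_n ≅ X_n`. -/
inductive HasResolution (X : ObjectProperty C) : ℕ → C → Prop
  | zero {W Z : C} (e : W ≅ Z) (hW : X W) : HasResolution X 0 Z
  | succ {n : ℕ} {K W Z : C} (f : K ⟶ W) (g : W ⟶ Z) (h : D.conflation f g) (hW : X W)
      (hK : HasResolution X n K) : HasResolution X (n + 1) Z

/-- `HasCoresolution D X n Z`: there is a finite `X`-coresolution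
`0 ⟶ Z ⟶ X_0 ⟶ X_{-1} ⟶ ⋯ ⟶ X_{-n} ⟶ 0` of length `n`. -/
inductive HasCoresolution (X : ObjectProperty C) : ℕ → C → Prop
  | zero {W Z : C} (e : Z ≅ W) (hW : X W) : HasCoresolution X 0 Z
  | succ {n : ℕ} {Z W K : C} (f : Z ⟶ W) (g : W ⟶ K) (h : D.conflation f g) (hW : X W)
      (hK : HasCoresolution X n K) : HasCoresolution X (n + 1) Z

/-- The class `X^∧_n` of the objects of `X`-resolution dimension at most `n`. -/
def wedgeLE (X : ObjectProperty C) (n : ℕ) : ObjectProperty C :=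
  fun Z => ∃ m ≤ n, HasResolution D X m Z

/-- The class `X^∧` of the objects of finite `X`-resolution dimension. -/
def wedge (X : ObjectProperty C) : ObjectProperty C :=
  fun Z => ∃ n, wedgeLE D X n Z

/-- The class `X^∨_n` of the objects of `X`-coresolution dimension at most `n`. -/
def veeLE (X : ObjectProperty C) (n : ℕ) : ObjectProperty C :=
  fun Z => ∃ m ≤ n, HasCoresolution D X m Z

/-- `𝔼^i(X, Y) = 0` for classes `X`, `Y` of objects. -/
def ExtVanish (i : ℕ) (X Y : ObjectProperty C) : Prop :=
  ∀ ⦃A B : C⦄, X A → Y B → Subsingleton (D.E i A B)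

/-- The relative projective dimension `pd_X(Y) = sup_{Z ∈ Y} min {m ≥ 0 : 𝔼^{≥ m+1}(Z, X) = 0}`,
in `ℕ ∪ {∞}`. -/
noncomputable def relPd (X Y : ObjectProperty C) : ℕ∞ :=
  ⨆ (Z : C) (_ : Y Z), ⨅ (m : ℕ)
    (_ : ∀ j, m + 1 ≤ j → ExtVanish D j (ObjectProperty.singleton Z) X), (m : ℕ∞)

/-- The relative injective dimension `id_X(Y) = sup_{Z ∈ Y} min {m ≥ 0 : 𝔼^{≥ m+1}(X, Z) = 0}`,
in `ℕ ∪ {∞}`. -/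
noncomputable def relId (X Y : ObjectProperty C) : ℕ∞ :=
  ⨆ (Z : C) (_ : Y Z), ⨅ (m : ℕ)
    (_ : ∀ j, m + 1 ≤ j → ExtVanish D j X (ObjectProperty.singleton Z)), (m : ℕ∞)

/-- `ω` is a relative cogenerator in `X`. -/
def IsRelCogenerator (ω X : ObjectProperty C) : Prop :=
  ω ≤ X ∧ ∀ ⦃A : C⦄, X A → ∃ (W A' : C) (f : A ⟶ W) (g : W ⟶ A'),
    D.conflation f g ∧ ω W ∧ X A'

/-- `ω` is a relative generator in `X`. -/
def IsRelGenerator (ω X : ObjectProperty C) : Prop :=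
  ω ≤ X ∧ ∀ ⦃A : C⦄, X A → ∃ (A' W : C) (f : A' ⟶ W) (g : W ⟶ A),
    D.conflation f g ∧ ω W ∧ X A'

/-- `(X, ω)` is a left Frobenius pair. -/
structure IsLeftFrobeniusPair [HasZeroMorphisms C] (X ω : ObjectProperty C) : Prop where
  leftThick : IsLeftThick D X
  summands : ClosedUnderSummands ω
  injective : relId D X ω = 0
  cogenerator : IsRelCogenerator D ω X

/-- `(X, ω)` is a left Frobenius pair cut on `S`. -/
structure IsLeftFrobeniusPairCut [HasZeroMorphisms C] (X ω S : ObjectProperty C) : Prop where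
  leftThick : IsLeftThick D X
  frobenius : IsLeftFrobeniusPair D (X ⊓ S) (ω ⊓ S)
  projective : relPd D ω (ω ⊓ S) = 0
  generator : IsRelGenerator D (ω ⊓ S) ω
  extensions : ClosedUnderExtensions D ω
  summands : ClosedUnderSummands ω

/-- `(A, B)` is a left weak AB-context cut on `S`. -/
structure IsLeftWeakABContextCut [HasZeroMorphisms C] (A B S : ObjectProperty C) : Prop where
  frobenius : IsLeftFrobeniusPairCut D A (A ⊓ B) S
  rightThick : IsRightThick D (B ⊓ S)
  le_wedge : B ⊓ S ≤ wedge D (A ⊓ S)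

/-- `(A, B)` is a left weak AB-context in `C`, that is, one cut on all of `C`. -/
def IsLeftWeakABContext [HasZeroMorphisms C] (A B : ObjectProperty C) : Prop :=
  IsLeftWeakABContextCut D A B ⊤

/-- `(A, B)` is a left `n`-cotorsion pair cut on `S` (for `1 ≤ n`). -/
structure IsLeftCotorsionPairCut [HasZeroMorphisms C] (n : ℕ) (A B S : ObjectProperty C) :
    Prop where
  summands : ClosedUnderSummands A
  vanish : ∀ i, 1 ≤ i → i ≤ n → ExtVanish D i (A ⊓ S) B
  complete : ∀ ⦃Z : C⦄, S Z → ∃ (K W : C) (f : K ⟶ W) (g : W ⟶ Z),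
    D.conflation f g ∧ A W ∧ wedgeLE D B (n - 1) K

/-- `(A, B)` is a right `n`-cotorsion pair cut on `S` (for `1 ≤ n`). -/
structure IsRightCotorsionPairCut [HasZeroMorphisms C] (n : ℕ) (A B S : ObjectProperty C) :
    Prop where
  summands : ClosedUnderSummands B
  vanish : ∀ i, 1 ≤ i → i ≤ n → ExtVanish D i A (B ⊓ S)
  complete : ∀ ⦃Z : C⦄, S Z → ∃ (W K : C) (f : Z ⟶ W) (g : W ⟶ K),
    D.conflation f g ∧ B W ∧ veeLE D A (n - 1) K

/-- `(A, B)` is an `n`-cotorsion pair cut on `S` (for `1 ≤ n`). -/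
def IsCotorsionPairCut [HasZeroMorphisms C] (n : ℕ) (A B S : ObjectProperty C) : Prop :=
  IsLeftCotorsionPairCut D n A B S ∧ IsRightCotorsionPairCut D n A B S

end Notions

/-! ### Yoneda extension groups with respect to a class of conflations -/

section Yoneda

variable {C : Type u} [Category.{v} C]
  (conf : ∀ ⦃A B Z : C⦄, (A ⟶ B) → (B ⟶ Z) → Prop)

/-- `YonedaSeq conf B n A` is the type of the exact sequences
`0 ⟶ B ⟶ E_n ⟶ ⋯ ⟶ E_1 ⟶ A ⟶ 0` of length `n`, spliced from `n` conflations
`K_i ⟶ E_i ⟶ K_{i-1}` with `K_0 = A` and `K_n = B`. -/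
inductive YonedaSeq (B : C) : ℕ → C → Type (max u v)
  | nil : YonedaSeq B 0 B
  | splice {n : ℕ} {K M A : C} (f : K ⟶ M) (g : M ⟶ A) (h : conf f g)
      (x : YonedaSeq B n K) : YonedaSeq B (n + 1) A

/-- `YonedaSeq.Hom conf B x x' a`: there is a morphism of exact sequences from `x` to `x'` which
is the identity on the left end `B` and is `a` on the right ends. -/
inductive YonedaSeq.Hom (B : C) : ∀ {n : ℕ} {A A' : C},
    YonedaSeq conf B n A → YonedaSeq conf B n A' → (A ⟶ A') → Prop
  | nil : YonedaSeq.Hom B .nil .nil (𝟙 B)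
  | splice {n : ℕ} {K M A K' M' A' : C} {f : K ⟶ M} {g : M ⟶ A} {h : conf f g}
      {x : YonedaSeq conf B n K} {f' : K' ⟶ M'} {g' : M' ⟶ A'} {h' : conf f' g'}
      {x' : YonedaSeq conf B n K'} (k : K ⟶ K') (m : M ⟶ M') (a : A ⟶ A')
      (hf : f ≫ m = k ≫ f') (hg : g ≫ a = m ≫ g') (hx : YonedaSeq.Hom B x x' k) :
      YonedaSeq.Hom B (.splice f g h x) (.splice f' g' h' x') a

/-- The Yoneda extension group `Ext^n(A, B)` (its underlying set): morphisms for `n = 0`; for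
`n ≥ 1`, exact sequences of length `n` from `B` to `A`, modulo the equivalence relation
generated by the morphisms of exact sequences that are the identity on both ends. -/
def YonedaExt : ℕ → C → C → Type (max u v)
  | 0, A, B => ULift.{max u v} (A ⟶ B)
  | n + 1, A, B => Quot (fun x x' : YonedaSeq conf B (n + 1) A => YonedaSeq.Hom conf B x x' (𝟙 A))

end Yoneda

/-! ### Triangulated categories and their exact subcategories -/

section Triangulated

variable {T : Type u} [Category.{v} T] [HasZeroObject T] [HasShift T ℤ] [Preadditive T]
  [∀ n : ℤ, (shiftFunctor T n).Additive] [Pretriangulated T]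

/-- `A ⟶ B ⟶ Z` extends to a distinguished triangle `A ⟶ B ⟶ Z ⟶ A⟦1⟧`. -/
def TriConflation ⦃A B Z : T⦄ (f : A ⟶ B) (g : B ⟶ Z) : Prop :=
  ∃ h : Z ⟶ A⟦(1 : ℤ)⟧, Triangle.mk f g h ∈ distTriang T

variable (T) in
/-- The structure of a triangulated category: conflations come from distinguished triangles, and
`𝔼^i(X, Y) = Hom(X, Y⟦i⟧)`. -/
def triangulatedData : ExtriData.{v} T where
  conflation := TriConflation
  E i X Y := ShiftedHom X Y (i : ℤ)

/-- The conflations of a full subcategory `H` of `T`: the pairs of morphisms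
`A ⟶ B ⟶ Z` of `H` that extend to a distinguished triangle of `T`. -/
def ExactConflation (H : ObjectProperty T) ⦃A B Z : H.FullSubcategory⦄ (f : A ⟶ B) (g : B ⟶ Z) :
    Prop :=
  TriConflation (H.ι.map f) (H.ι.map g)

/-- The structure of an exact category on a full subcategory `H` of `T`, with its Yoneda extension
groups. -/
def exactData (H : ObjectProperty T) : ExtriData.{max u v} H.FullSubcategory where
  conflation := ExactConflation H
  E := YonedaExt (ExactConflation H)

/-- The conditions under which the conflations above make the full subcategory `H` of `T` an exact
category: `H` is closed under extensions, contains a zero object, and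
`Hom(A, B⟦-1⟧) = 0` for all `A`, `B` in `H`. -/
structure IsExactSubcategory (H : ObjectProperty T) : Prop where
  extensions : ClosedUnderExtensions (triangulatedData T) H
  zero : ∃ Z : T, IsZero Z ∧ H Z
  neg : ∀ ⦃A B : T⦄, H A → H B → ∀ f : A ⟶ B⟦(-1 : ℤ)⟧, f = 0

/-- The connecting morphism `Z ⟶ A⟦1⟧` of a conflation of `H`. By `connecting_naturality` below,
it is uniquely determined. -/
noncomputable def connecting {H : ObjectProperty T} {A B Z : H.FullSubcategory} {f : A ⟶ B}
    {g : B ⟶ Z} (h : ExactConflation H f g) : ShiftedHom Z.obj A.obj (1 : ℤ) :=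
  h.choose

lemma IsExactSubcategory.eq_zero {H : ObjectProperty T} (hH : IsExactSubcategory H) {A B : T}
    (hA : H A) (hB : H B) (g : A⟦(1 : ℤ)⟧ ⟶ B) : g = 0 := by
  apply (shiftFunctor T (-1 : ℤ)).map_injective
  rw [Functor.map_zero]
  have := hH.neg hA hB ((shiftShiftNeg A (1 : ℤ)).inv ≫ g⟦(-1 : ℤ)⟧')
  rwa [Preadditive.IsIso.comp_left_eq_zero] at this

/-- Connecting morphisms are natural, for any choice of the two distinguished triangles. -/
lemma connecting_naturality {H : ObjectProperty T} (hH : IsExactSubcategory H)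
    {A B Z A' B' Z' : T} (hA : H A) (hZ' : H Z') {f : A ⟶ B} {g : B ⟶ Z} {d : Z ⟶ A⟦(1 : ℤ)⟧}
    (hd : Triangle.mk f g d ∈ distTriang T) {f' : A' ⟶ B'} {g' : B' ⟶ Z'} {d' : Z' ⟶ A'⟦(1 : ℤ)⟧}
    (hd' : Triangle.mk f' g' d' ∈ distTriang T) (k : A ⟶ A') (m : B ⟶ B') (a : Z ⟶ Z')
    (hf : f ≫ m = k ≫ f') (hg : g ≫ a = m ≫ g') : d ≫ k⟦(1 : ℤ)⟧' = a ≫ d' := by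
  obtain ⟨c, hc₁, hc₂⟩ := complete_distinguished_triangle_morphism _ _ hd hd' k m hf
  change Z ⟶ Z' at c
  change g ≫ c = m ≫ g' at hc₁
  change d ≫ k⟦(1 : ℤ)⟧' = c ≫ d' at hc₂
  have h0 : g ≫ (c - a) = 0 := by rw [Preadditive.comp_sub, hc₁, hg, sub_self]
  obtain ⟨e, he⟩ := Triangle.yoneda_exact₃ _ hd (c - a) h0
  have he0 : e = 0 := hH.eq_zero hA hZ' e
  have hca : c - a = 0 := by
    subst he0
    exact he.trans comp_zero
  rw [hc₂, sub_eq_zero.1 hca]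

/-- The composite `A ⟶ K_1⟦1⟧ ⟶ K_2⟦2⟧ ⟶ ⋯ ⟶ B⟦n⟧` of the connecting morphisms of an exact
sequence of length `n` in `H`. -/
noncomputable def YonedaSeq.toShiftedHom {H : ObjectProperty T} {B : H.FullSubcategory} :
    ∀ {n : ℕ} {A : H.FullSubcategory}, YonedaSeq (ExactConflation H) B n A →
      ShiftedHom A.obj B.obj (n : ℤ)
  | _, _, .nil => ShiftedHom.mk₀ _ (by simp) (𝟙 B.obj)
  | _, _, .splice _ _ h x => (connecting h).comp x.toShiftedHom (by push_cast; ring)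

lemma YonedaSeq.Hom.comp_toShiftedHom {H : ObjectProperty T} (hH : IsExactSubcategory H)
    {B : H.FullSubcategory} {n : ℕ} {A A' : H.FullSubcategory}
    {x : YonedaSeq (ExactConflation H) B n A} {x' : YonedaSeq (ExactConflation H) B n A'}
    {a : A ⟶ A'} (hx : YonedaSeq.Hom (ExactConflation H) B x x' a) :
    x.toShiftedHom = H.ι.map a ≫ x'.toShiftedHom := by
  induction hx with
  | nil => simp
  | @splice n K M A K' M' A' f g h x f' g' h' x' k m a hf hg hx ih =>
    have key := connecting_naturality hH K.property A'.property h.choose_spec h'.choose_spec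
      (H.ι.map k) (H.ι.map m) (H.ι.map a)
      (by rw [← Functor.map_comp, hf, Functor.map_comp])
      (by rw [← Functor.map_comp, hg, Functor.map_comp])
    simp only [YonedaSeq.toShiftedHom, ShiftedHom.comp, ih, Functor.map_comp, Category.assoc]
    exact (reassoc_of% key) _

/-- The comparison map `Ext^n_H(A, B) ⟶ Hom_T(A, B⟦n⟧)`. -/
noncomputable def extComparison {H : ObjectProperty T} (hH : IsExactSubcategory H) :
    ∀ (n : ℕ) (A B : H.FullSubcategory), YonedaExt (ExactConflation H) n A B →
      ShiftedHom A.obj B.obj (n : ℤ)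
  | 0, _, _ => fun f => ShiftedHom.mk₀ _ (by simp) (H.ι.map f.down)
  | _ + 1, _, _ => Quot.lift YonedaSeq.toShiftedHom (fun x x' hx => by
      simpa using hx.comp_toShiftedHom hH)

/-- `T` has all the Ext groups of `H`: the comparison maps `Ext^n_H(A, B) ⟶ Hom_T(A, B⟦n⟧)` are
bijective. -/
def HasAllExtGroups {H : ObjectProperty T} (hH : IsExactSubcategory H) : Prop :=
  ∀ (n : ℕ) (A B : H.FullSubcategory), Function.Bijective (extComparison hH n A B)

end Triangulated

end CutAB

/-! Every condition in the three notions, except closure under cones or cocones, passes from `H` to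
`T` unchanged. A triangle with all three terms in `H` is by definition a conflation of `H`. Closure
of `H` under extensions and summands puts the middle term of a triangle with ends in `H`, and every
summand of an object of `H`, back into `H`. Finally, `T(A, B[i])` is the image of `Ext^i_H(A, B)`,
so vanishing of Ext carries over.

Cones and cocones can leave `H`, and this is where shifts enter. Rotating `A ⟶ B ⟶ Z` presents `A`
as an extension of `B` by `Z[-1]`, and `Z` as an extension of `A[1]` by `B`. So a class closed under
extensions and under `[-1]` (resp. `[1]`) is closed under cocones (resp. cones). Conversely, the
triangle `A ⟶ 0 ⟶ A[1]` shows that left thick classes of `T` are stable under `[-1]` and right thick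
ones under `[1]`. Cotorsion pairs involve no such closure, so they need no shift condition. -/

namespace CutAB

section Notions

variable {C : Type u} [Category.{v} C] (D : ExtriData.{w} C)

/-- An infimum of natural numbers in `ℕ∞` that equals `0` is attained, so the bound `m = 0` itself
is admissible for each object. -/
lemma relPd_eq_zero_iff (X Y : ObjectProperty C) :
    relPd D X Y = 0 ↔ ∀ i, 1 ≤ i → ExtVanish D i Y X := by
  simp only [relPd, ENat.iSup_eq_zero, ENat.iInf_eq_zero, exists_prop, Nat.cast_eq_zero]
  constructor
  · intro h i hi A B hA hB
    obtain ⟨m, hm, rfl⟩ := h A hA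
    exact hm i (by omega) ((ObjectProperty.singleton_iff A A).2 rfl) hB
  · intro h Z hZ
    refine ⟨0, fun j hj A B hA hB => ?_, rfl⟩
    obtain rfl := (ObjectProperty.singleton_iff _ _).1 hA
    exact h j (by omega) hZ hB

lemma relId_eq_zero_iff (X Y : ObjectProperty C) :
    relId D X Y = 0 ↔ ∀ i, 1 ≤ i → ExtVanish D i X Y := by
  simp only [relId, ENat.iSup_eq_zero, ENat.iInf_eq_zero, exists_prop, Nat.cast_eq_zero]
  constructor
  · intro h i hi A B hA hB
    obtain ⟨m, hm, rfl⟩ := h B hB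
    exact hm i (by omega) hA ((ObjectProperty.singleton_iff B B).2 rfl)
  · intro h Z hZ
    refine ⟨0, fun j hj A B hA hB => ?_, rfl⟩
    obtain rfl := (ObjectProperty.singleton_iff _ _).1 hB
    exact h j (by omega) hA hZ

end Notions

/-! ### Direct summands -/

section Summands

variable {C : Type u} [Category.{v} C] [Preadditive C] {X : ObjectProperty C}

lemma ClosedUnderSummands.snd (hX : ClosedUnderSummands X) {A B : C} (b : BinaryBicone A B)
    (hb : b.IsBilimit) (h : X b.pt) : X B :=
  hX { pt := b.pt, fst := b.snd, snd := b.fst, inl := b.inr, inr := b.inl }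
    ⟨isBinaryBilimitOfTotal _ ((add_comm _ _).trans (IsBilimit.binary_total hb))⟩ h

/-- Both summands of an object of `X` lie in `H`, so the whole biproduct diagram lives in the full
subcategory, where the hypothesis applies. -/
lemma ClosedUnderSummands.of_inverseImage {H : ObjectProperty C} (hH : ClosedUnderSummands H)
    (hXH : X ≤ H) (hX : ClosedUnderSummands (X.inverseImage H.ι)) : ClosedUnderSummands X := by
  rintro A B b ⟨hb⟩ h
  have hA : H A := hH b ⟨hb⟩ (hXH _ h)
  have hB : H B := hH.snd b hb (hXH _ h)
  let b' : BinaryBicone (⟨A, hA⟩ : H.FullSubcategory) ⟨B, hB⟩ :=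
    { pt := ⟨b.pt, hXH _ h⟩
      fst := ObjectProperty.homMk b.fst
      snd := ObjectProperty.homMk b.snd
      inl := ObjectProperty.homMk b.inl
      inr := ObjectProperty.homMk b.inr
      inl_fst := H.hom_ext b.inl_fst
      inl_snd := H.hom_ext b.inl_snd
      inr_fst := H.hom_ext b.inr_fst
      inr_snd := H.hom_ext b.inr_snd }
  exact hX b' ⟨isBinaryBilimitOfTotal b' (H.hom_ext (IsBilimit.binary_total hb))⟩ h

variable [HasZeroObject C]

open ZeroObject

lemma ClosedUnderSummands.of_iso (hX : ClosedUnderSummands X) {A B : C} (e : A ≅ B) (hA : X A) :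
    X B :=
  -- `A` is a biproduct of `B` and `0`.
  hX (B := 0) { pt := A, fst := e.hom, snd := 0, inl := e.inv, inr := 0 }
    ⟨isBinaryBilimitOfTotal _ (by simp)⟩ hA

lemma ClosedUnderSummands.zero (hX : ClosedUnderSummands X) {A : C} (hA : X A) : X (0 : C) :=
  -- `A` is a biproduct of `0` and `A`.
  hX { pt := A, fst := 0, snd := 𝟙 A, inl := 0, inr := 𝟙 A }
    ⟨isBinaryBilimitOfTotal _ (by simp)⟩ hA

end Summands

/-! ### Thickness and shifts; passage from `H` to `T` -/

section Triangulated

variable {T : Type u} [Category.{v} T] [HasZeroObject T] [HasShift T ℤ] [Preadditive T]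
  [∀ n : ℤ, (shiftFunctor T n).Additive] [Pretriangulated T]

open ZeroObject

lemma triConflation_zero (A : T) :
    TriConflation (0 : A ⟶ 0) (0 : 0 ⟶ A⟦(1 : ℤ)⟧) :=
  ⟨_, rot_of_distTriang _ (contractible_distinguished A)⟩

lemma TriConflation.exists_invRotate {A B Z : T} {f : A ⟶ B} {g : B ⟶ Z}
    (h : TriConflation f g) : ∃ d : Z⟦(-1 : ℤ)⟧ ⟶ A, TriConflation d f := by
  obtain ⟨_, hd⟩ := h
  exact ⟨_, _, inv_rot_of_distTriang _ hd⟩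

lemma TriConflation.exists_rotate {A B Z : T} {f : A ⟶ B} {g : B ⟶ Z}
    (h : TriConflation f g) : ∃ d : Z ⟶ A⟦(1 : ℤ)⟧, TriConflation g d := by
  obtain ⟨d, hd⟩ := h
  exact ⟨d, _, rot_of_distTriang _ hd⟩

/-- `A[-1]` is the cocone of `0 ⟶ A`, up to the isomorphism `A[-1][1] ≅ A`. -/
lemma IsLeftThick.shift_neg_one {X : ObjectProperty T} (hX : IsLeftThick (triangulatedData T) X)
    {A : T} (hA : X A) : X (A⟦(-1 : ℤ)⟧) :=
  hX.cocones _ _ (triConflation_zero (A⟦(-1 : ℤ)⟧)) (hX.summands.zero hA)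
    (hX.summands.of_iso (shiftNegShift A (1 : ℤ)).symm hA)

lemma IsRightThick.shift_one {X : ObjectProperty T} (hX : IsRightThick (triangulatedData T) X)
    {A : T} (hA : X A) : X (A⟦(1 : ℤ)⟧) :=
  hX.cones _ _ (triConflation_zero A) hA (hX.summands.zero hA)

variable {H : ObjectProperty T}

lemma ClosedUnderExtensions.of_inverseImage
    (hH : ClosedUnderExtensions (triangulatedData T) H) {X : ObjectProperty T} (hXH : X ≤ H)
    (hX : ClosedUnderExtensions (exactData H) (X.inverseImage H.ι)) :
    ClosedUnderExtensions (triangulatedData T) X := fun A B Z f g h hA hZ =>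
  hX (A := ⟨A, hXH _ hA⟩) (B := ⟨B, hH f g h (hXH _ hA) (hXH _ hZ)⟩) (Z := ⟨Z, hXH _ hZ⟩)
    (ObjectProperty.homMk f) (ObjectProperty.homMk g) h hA hZ

lemma IsLeftThick.of_inverseImage (hH : ClosedUnderExtensions (triangulatedData T) H)
    (hH' : ClosedUnderSummands H) {X : ObjectProperty T} (hXH : X ≤ H)
    (hX : IsLeftThick (exactData H) (X.inverseImage H.ι))
    (hshift : ∀ A : T, X A → X (A⟦(-1 : ℤ)⟧)) : IsLeftThick (triangulatedData T) X where
  extensions := hH.of_inverseImage hXH hX.extensions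
  summands := hH'.of_inverseImage hXH hX.summands
  cocones A B Z f g h hB hZ := by
    obtain ⟨d, hd⟩ := TriConflation.exists_invRotate h
    -- In `Z[-1] ⟶ A ⟶ B` both ends are in `X`, so `A` is too; it was not known beforehand to lie in
    -- `H`.
    exact hH.of_inverseImage hXH hX.extensions d f hd (hshift _ hZ) hB

lemma IsRightThick.of_inverseImage (hH : ClosedUnderExtensions (triangulatedData T) H)
    (hH' : ClosedUnderSummands H) {X : ObjectProperty T} (hXH : X ≤ H)
    (hX : IsRightThick (exactData H) (X.inverseImage H.ι))
    (hshift : ∀ A : T, X A → X (A⟦(1 : ℤ)⟧)) : IsRightThick (triangulatedData T) X where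
  extensions := hH.of_inverseImage hXH hX.extensions
  summands := hH'.of_inverseImage hXH hX.summands
  cones A B Z f g h hA hB := by
    obtain ⟨d, hd⟩ := TriConflation.exists_rotate h
    exact hH.of_inverseImage hXH hX.extensions g d hd hB (hshift _ hA)

lemma IsRelCogenerator.of_inverseImage {ω X : ObjectProperty T} (hωH : ω ≤ H) (hXH : X ≤ H)
    (h : IsRelCogenerator (exactData H) (ω.inverseImage H.ι) (X.inverseImage H.ι)) :
    IsRelCogenerator (triangulatedData T) ω X := by
  refine ⟨fun A hA => h.1 ⟨A, hωH _ hA⟩ hA, fun A hA => ?_⟩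
  obtain ⟨W, A', f, g, hfg, hW, hA'⟩ := h.2 (A := ⟨A, hXH _ hA⟩) hA
  exact ⟨W.obj, A'.obj, f.hom, g.hom, hfg, hW, hA'⟩

lemma IsRelGenerator.of_inverseImage {ω X : ObjectProperty T} (hωH : ω ≤ H) (hXH : X ≤ H)
    (h : IsRelGenerator (exactData H) (ω.inverseImage H.ι) (X.inverseImage H.ι)) :
    IsRelGenerator (triangulatedData T) ω X := by
  refine ⟨fun A hA => h.1 ⟨A, hωH _ hA⟩ hA, fun A hA => ?_⟩
  obtain ⟨A', W, f, g, hfg, hW, hA'⟩ := h.2 (A := ⟨A, hXH _ hA⟩) hA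
  exact ⟨A'.obj, W.obj, f.hom, g.hom, hfg, hW, hA'⟩

lemma HasResolution.map_ι {X : ObjectProperty T} {n : ℕ} {Z : H.FullSubcategory}
    (h : HasResolution (exactData H) (X.inverseImage H.ι) n Z) :
    HasResolution (triangulatedData T) X n Z.obj := by
  induction h with
  | zero e hW => exact .zero (H.ι.mapIso e) hW
  | succ f g h hW _ ih => exact .succ f.hom g.hom h hW ih

lemma HasCoresolution.map_ι {X : ObjectProperty T} {n : ℕ} {Z : H.FullSubcategory}
    (h : HasCoresolution (exactData H) (X.inverseImage H.ι) n Z) :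
    HasCoresolution (triangulatedData T) X n Z.obj := by
  induction h with
  | zero e hW => exact .zero (H.ι.mapIso e) hW
  | succ f g h hW _ ih => exact .succ f.hom g.hom h hW ih

lemma wedgeLE.map_ι {X : ObjectProperty T} {n : ℕ} {Z : H.FullSubcategory}
    (h : wedgeLE (exactData H) (X.inverseImage H.ι) n Z) :
    wedgeLE (triangulatedData T) X n Z.obj := by
  obtain ⟨m, hm, h⟩ := h
  exact ⟨m, hm, h.map_ι⟩

lemma veeLE.map_ι {X : ObjectProperty T} {n : ℕ} {Z : H.FullSubcategory}
    (h : veeLE (exactData H) (X.inverseImage H.ι) n Z) :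
    veeLE (triangulatedData T) X n Z.obj := by
  obtain ⟨m, hm, h⟩ := h
  exact ⟨m, hm, h.map_ι⟩

/-- Surjectivity of the comparison map suffices: the image of a subsingleton is a subsingleton. -/
lemma ExtVanish.of_inverseImage {hH : IsExactSubcategory H} (hExt : HasAllExtGroups hH)
    {X Y : ObjectProperty T} (hXH : X ≤ H) (hYH : Y ≤ H) {i : ℕ}
    (h : ExtVanish (exactData H) i (X.inverseImage H.ι) (Y.inverseImage H.ι)) :
    ExtVanish (triangulatedData T) i X Y := fun A B hA hB =>
  have : Subsingleton (YonedaExt (ExactConflation H) i ⟨A, hXH _ hA⟩ ⟨B, hYH _ hB⟩) := h hA hB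
  (hExt i ⟨A, hXH _ hA⟩ ⟨B, hYH _ hB⟩).2.subsingleton

lemma IsLeftFrobeniusPair.of_inverseImage {hH : IsExactSubcategory H}
    (hH' : ClosedUnderSummands H) (hExt : HasAllExtGroups hH) {X ω : ObjectProperty T}
    (hXH : X ≤ H) (hωH : ω ≤ H)
    (h : IsLeftFrobeniusPair (exactData H) (X.inverseImage H.ι) (ω.inverseImage H.ι))
    (hshift : ∀ A : T, X A → X (A⟦(-1 : ℤ)⟧)) :
    IsLeftFrobeniusPair (triangulatedData T) X ω where
  leftThick := h.leftThick.of_inverseImage hH.extensions hH' hXH hshift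
  summands := hH'.of_inverseImage hωH h.summands
  injective := (relId_eq_zero_iff _ _ _).2 fun i hi =>
    ((relId_eq_zero_iff _ _ _).1 h.injective i hi).of_inverseImage hExt hXH hωH
  cogenerator := h.cogenerator.of_inverseImage hωH hXH

lemma IsLeftFrobeniusPairCut.of_inverseImage {hH : IsExactSubcategory H}
    (hH' : ClosedUnderSummands H) (hExt : HasAllExtGroups hH) {X ω : ObjectProperty T}
    (hXH : X ≤ H) (hωH : ω ≤ H)
    (h : IsLeftFrobeniusPairCut (exactData H) (X.inverseImage H.ι) (ω.inverseImage H.ι) ⊤)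
    (hshift : ∀ A : T, X A → X (A⟦(-1 : ℤ)⟧)) :
    IsLeftFrobeniusPairCut (triangulatedData T) X ω ⊤ := by
  obtain ⟨hthick, hfrob, hproj, hgen, hext, hsum⟩ := h
  simp only [inf_top_eq] at hfrob hproj hgen
  refine ⟨hthick.of_inverseImage hH.extensions hH' hXH hshift, ?_, ?_, ?_,
    hH.extensions.of_inverseImage hωH hext, hH'.of_inverseImage hωH hsum⟩ <;>
    rw [inf_top_eq]
  · rw [inf_top_eq]
    exact hfrob.of_inverseImage hH' hExt hXH hωH hshift
  · exact (relPd_eq_zero_iff _ _ _).2 fun i hi =>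
      ((relPd_eq_zero_iff _ _ _).1 hproj i hi).of_inverseImage hExt hωH hωH
  · exact hgen.of_inverseImage hωH hωH

lemma IsLeftWeakABContext.of_inverseImage {hH : IsExactSubcategory H}
    (hH' : ClosedUnderSummands H) (hExt : HasAllExtGroups hH) {A B : ObjectProperty T}
    (hAH : A ≤ H) (hBH : B ≤ H)
    (h : IsLeftWeakABContext (exactData H) (A.inverseImage H.ι) (B.inverseImage H.ι))
    (hA : ∀ M : T, A M → A (M⟦(-1 : ℤ)⟧)) (hB : ∀ M : T, B M → B (M⟦(1 : ℤ)⟧)) :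
    IsLeftWeakABContext (triangulatedData T) A B := by
  obtain ⟨hfrob, hthick, hwedge⟩ := h
  simp only [inf_top_eq] at hthick hwedge
  -- Here `ω = A ⊓ B`, and inverse image commutes with `⊓` definitionally. Only `A` has to be stable
  -- under `[-1]`: no cocone closure is asked of `ω`.
  refine ⟨IsLeftFrobeniusPairCut.of_inverseImage hH' hExt hAH (inf_le_left.trans hAH) hfrob hA,
    ?_, ?_⟩ <;> simp only [inf_top_eq]
  · exact hthick.of_inverseImage hH.extensions hH' hBH hB
  · intro M hM
    obtain ⟨n, hn⟩ := hwedge ⟨M, hBH _ hM⟩ hM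
    exact ⟨n, hn.map_ι⟩

lemma IsCotorsionPairCut.of_inverseImage {hH : IsExactSubcategory H}
    (hH' : ClosedUnderSummands H) (hExt : HasAllExtGroups hH) {n : ℕ} {F G S : ObjectProperty T}
    (hFH : F ≤ H) (hGH : G ≤ H) (hSH : S ≤ H)
    (h : IsCotorsionPairCut (exactData H) n (F.inverseImage H.ι) (G.inverseImage H.ι)
      (S.inverseImage H.ι)) :
    IsCotorsionPairCut (triangulatedData T) n F G S := by
  obtain ⟨hl, hr⟩ := h
  refine ⟨⟨hH'.of_inverseImage hFH hl.summands, fun i hi hin =>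
      ExtVanish.of_inverseImage hExt (inf_le_left.trans hFH) hGH (hl.vanish i hi hin),
      fun Z hZ => ?_⟩,
    ⟨hH'.of_inverseImage hGH hr.summands, fun i hi hin =>
      ExtVanish.of_inverseImage hExt hFH (inf_le_left.trans hGH) (hr.vanish i hi hin),
      fun Z hZ => ?_⟩⟩
  · obtain ⟨K, W, f, g, hfg, hW, hK⟩ := hl.complete (Z := ⟨Z, hSH _ hZ⟩) hZ
    exact ⟨K.obj, W.obj, f.hom, g.hom, hfg, hW, hK.map_ι⟩
  · obtain ⟨W, K, f, g, hfg, hW, hK⟩ := hr.complete (Z := ⟨Z, hSH _ hZ⟩) hZ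
    exact ⟨W.obj, K.obj, f.hom, g.hom, hfg, hW, hK.map_ι⟩

end Triangulated

end CutAB

theorem proposition6p4 {T : Type u} [Category.{v} T] [HasZeroObject T] [HasShift T ℤ]
    [Preadditive T] [∀ n : ℤ, (shiftFunctor T n).Additive] [Pretriangulated T] [IsTriangulated T]
    (H : ObjectProperty T) (hH : CutAB.IsExactSubcategory H)
    (hsummands : CutAB.ClosedUnderSummands H) (hExt : CutAB.HasAllExtGroups hH) :
    (∀ X ω : ObjectProperty T, X ≤ H → ω ≤ H →
      CutAB.IsLeftFrobeniusPair (CutAB.exactData H) (X.inverseImage H.ι) (ω.inverseImage H.ι) →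
      (CutAB.IsLeftFrobeniusPair (CutAB.triangulatedData T) X ω ↔
        ∀ A : T, X A → X (A⟦(-1 : ℤ)⟧))) ∧
    (∀ A B : ObjectProperty T, A ≤ H → B ≤ H →
      CutAB.IsLeftWeakABContext (CutAB.exactData H) (A.inverseImage H.ι) (B.inverseImage H.ι) →
      (CutAB.IsLeftWeakABContext (CutAB.triangulatedData T) A B ↔
        (∀ M : T, A M → A (M⟦(-1 : ℤ)⟧)) ∧ (∀ M : T, B M → B (M⟦(1 : ℤ)⟧)))) ∧
    (∀ n : ℕ, 1 ≤ n → ∀ F G S : ObjectProperty T, F ≤ H → G ≤ H → S ≤ H →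
      CutAB.IsCotorsionPairCut (CutAB.exactData H) n (F.inverseImage H.ι) (G.inverseImage H.ι)
        (S.inverseImage H.ι) →
      CutAB.IsCotorsionPairCut (CutAB.triangulatedData T) n F G S) := by
  refine ⟨fun X ω hX hω h => ⟨fun h' A hA => h'.leftThick.shift_neg_one hA,
      h.of_inverseImage hsummands hExt hX hω⟩,
    fun A B hA hB h => ⟨fun h' => ⟨fun M hM => h'.frobenius.leftThick.shift_neg_one hM,
        -- Right thickness is stated for `B ⊓ ⊤`, hence the trivial second component.
        fun M hM => (h'.rightThick.shift_one ⟨hM, trivial⟩).1⟩,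
      fun h' => h.of_inverseImage hsummands hExt hA hB h'.1 h'.2⟩,
    fun n _ F G S hF hG hS h => h.of_inverseImage hsummands hExt hF hG hS⟩
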